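/- For $\alpha>-1$ let $L_k^\alpha(x)=\sum_{i=0}^{k}(-1)^i\binom{k+\alpha}{k-i}\frac{x^i}{i!}$ denote the Laguerre polynomials. A function $f\colon[0,\infty)\to\mathbb{R}$ is said to have the $\alpha$-SILP property if (1) $f$ is continuous and there are $\varepsilon>0$ and $C>0$ with $|f(x)|\le C(1+x)^{-\alpha-1-\varepsilon}$ for all $x\ge 0$, and (2) for every $y>0$ and every integer $j\ge 0$ the Laguerre coefficient $$a_j(y)=\frac{\int_0^\infty f(x/y)\,L_j^\alpha(x)\,x^\alpha e^{-x}\,dx}{\int_0^\infty L_j^\alpha(x)^2\,x^\alpha e^{-x}\,dx}$$ of $x\mapsto f(x/y)$ is non-negative. Let $n>1$ be an integer and let $f\colon[0,\infty)\to\mathbb{R}$ be a function. Then $f$ has the $(n/2-1)$-SILP property if and only if the function $\mathbb{R}^n\to\mathbb{R}$, $x\mapsto f(|x|^2)$, is continuous, satisfies $$|f(|x|^2)|\le C(1+|x|)^{-n-\varepsilon}\quad\text{for all }x\in\mathbb{R}^n$$ for some $C>0$ and $\varepsilon>0$, and is the Fourier transform of a non-negative tempered distribution. Here the Fourier transform is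 normalized by $\widehat\varphi(t)=\int_{\mathbb{R}^n}\varphi(x)e^{2\pi i\langle t,x\rangle}\,dx$ and extended to tempered distributions by $\widehat T(\varphi)=T(\widehat\varphi)$, and a distribution $T$ is non-negative if $T(\varphi)\ge 0$ for every non-negative compactly supported smooth function $\varphi$. -/

import Mathlib

open scoped NNReal SchwartzMap FourierTransform

noncomputable section

/-- The (generalized) Laguerre polynomial of degree `k` and parameter `α > -1`,
`L_k^α(x) = ∑_{i ≤ k} (-1)^i binom(k+α, k-i) x^i / i!`, the binomial coefficient being
`Γ(k+α+1) / (Γ(α+i+1) (k-i)!)`. -/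
def laguerre (α : ℝ) (k : ℕ) (x : ℝ) : ℝ :=
  ∑ i ∈ Finset.range (k + 1),
    (-1) ^ i * (Real.Gamma (k + α + 1) / (Real.Gamma (α + i + 1) * (k - i).factorial))
      * (x ^ i / i.factorial)

/-- The `j`-th coefficient of the Laguerre series `∑ a_j L_j^α` of a function `g` on `[0,∞)`,
with respect to the weight `x^α e^{-x}`. -/
def laguerreCoeff (α : ℝ) (g : ℝ≥0 → ℝ) (j : ℕ) : ℝ :=
  (∫ x in Set.Ioi (0 : ℝ), g x.toNNReal * laguerre α j x * x ^ α * Real.exp (-x)) /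
    (∫ x in Set.Ioi (0 : ℝ), laguerre α j x ^ 2 * x ^ α * Real.exp (-x))

/-- The `α`-SILP property (scale-invariant Laguerre positivity) of `f : [0,∞) → ℝ`. -/
structure IsSILP (α : ℝ) (f : ℝ≥0 → ℝ) : Prop where
  continuous : Continuous f
  decay : ∃ ε > (0 : ℝ), ∃ C > (0 : ℝ), ∀ x : ℝ≥0, |f x| ≤ C * (1 + (x : ℝ)) ^ (-α - 1 - ε)
  coeff_nonneg : ∀ y : ℝ≥0, 0 < y → ∀ j : ℕ, 0 ≤ laguerreCoeff α (fun x => f (x / y)) j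

open scoped ComplexOrder in
/-- A tempered distribution is non-negative if it takes non-negative (real) values on all
non-negative, compactly supported smooth test functions. In `ℂ`, `0 ≤ z` means that `z` is real
and non-negative. -/
def IsNonnegDistribution {n : ℕ} (T : 𝓢'(EuclideanSpace ℝ (Fin n), ℂ)) : Prop :=
  ∀ φ : 𝓢(EuclideanSpace ℝ (Fin n), ℂ), HasCompactSupport φ → (∀ x, 0 ≤ φ x) → 0 ≤ T φ

/-- The tempered distribution `T` is given by integration against the function `F`. -/
def IsGivenBy {n : ℕ} (T : 𝓢'(EuclideanSpace ℝ (Fin n), ℂ))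
    (F : EuclideanSpace ℝ (Fin n) → ℝ) : Prop :=
  ∀ φ : 𝓢(EuclideanSpace ℝ (Fin n), ℂ),
    MeasureTheory.Integrable (fun x => φ x * (F x : ℂ)) ∧ T φ = ∫ x, φ x * (F x : ℂ)

/-- `F` is the Fourier transform of a non-negative (tempered) distribution. The Fourier transform
is normalized by `t ↦ ∫ φ x * exp (2πi⟪t, x⟫)`, with a plus sign in the exponent; this is what
Mathlib denotes by `𝓕⁻`, extended to tempered distributions by duality. -/
def IsFourierTransformOfNonneg {n : ℕ} (F : EuclideanSpace ℝ (Fin n) → ℝ) : Prop :=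
  ∃ T : 𝓢'(EuclideanSpace ℝ (Fin n), ℂ), IsNonnegDistribution T ∧ IsGivenBy (𝓕⁻ T) F

end

/-!
The Gaussian `exp (-b ‖x‖ ^ 2)` is its own Fourier transform up to scaling. Differentiating `j`
times in `b` shows that the transform of `‖x‖ ^ (2j) * exp (-b ‖x‖ ^ 2)` on a `d`-dimensional space
is a positive multiple of `L_j^(d/2-1) (y ‖w‖ ^ 2) * exp (-y ‖w‖ ^ 2)`, where `y = π ^ 2 / b`. By
Parseval, the Laguerre coefficient `a_j(y)` of `f` therefore has the sign of
`∫ w, 𝓕 F w * ‖w‖ ^ (2j) * exp (-b ‖w‖ ^ 2)`, where `F x = f (‖x‖ ^ 2)`, so all coefficients are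
non-negative if `𝓕 F` is. Conversely, in the variable `s = ‖w‖ ^ 2` these weights are, up to
positive constants, Gamma densities of shape `d / 2 + j` and rate `b`; letting `j → ∞` with
`(d / 2 + j) / b` fixed, they concentrate at that point (Post–Widder inversion), and since `𝓕 F` is
continuous and radial it is non-negative everywhere.
-/

section LaguerrePolynomial

open Polynomial Real MeasureTheory Set

/-- The Laguerre polynomial `L_k^α` as an element of `ℝ[X]`. The factor `1 / ((k - i)! i!)` is
written as `k.choose i / k!`, so that the formula for the coefficients is valid for all `i`. -/
noncomputable def laguerrePolynomial (α : ℝ) (k : ℕ) : ℝ[X] :=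
  ∑ i ∈ Finset.range (k + 1),
    C ((-1) ^ i * (k.choose i / k.factorial) * (Gamma (k + α + 1) / Gamma (α + i + 1))) * X ^ i

theorem eval_laguerrePolynomial (α : ℝ) (k : ℕ) (x : ℝ) :
    (laguerrePolynomial α k).eval x = laguerre α k x := by
  simp only [laguerrePolynomial, laguerre, eval_finsetSum, eval_mul, eval_C, eval_pow, eval_X]
  refine Finset.sum_congr rfl fun i hi => ?_
  rw [Nat.cast_choose ℝ (Finset.mem_range_succ_iff.1 hi)]
  field_simp

theorem coeff_laguerrePolynomial (α : ℝ) (k i : ℕ) :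
    (laguerrePolynomial α k).coeff i =
      (-1) ^ i * (k.choose i / k.factorial) * (Gamma (k + α + 1) / Gamma (α + i + 1)) := by
  simp only [laguerrePolynomial, finsetSum_coeff, coeff_C_mul_X_pow, Finset.sum_ite_eq,
    Finset.mem_range]
  split_ifs with hi
  · rfl
  · simp [Nat.choose_eq_zero_of_lt (by lia : k < i)]

theorem laguerrePolynomial_ne_zero {α : ℝ} (hα : -1 < α) (k : ℕ) : laguerrePolynomial α k ≠ 0 := by
  have hΓk : 0 < Gamma (k + α + 1) := Gamma_pos_of_pos (by linarith [k.cast_nonneg (α := ℝ)])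
  have hΓ : 0 < Gamma (α + 1) := Gamma_pos_of_pos (by linarith)
  have hcoeff : 0 < (laguerrePolynomial α k).coeff 0 := by
    simp only [coeff_laguerrePolynomial, pow_zero, Nat.choose_zero_right, Nat.cast_one,
      Nat.cast_zero, add_zero]
    positivity
  intro h
  simp [h] at hcoeff

theorem X_mul_derivative_laguerrePolynomial {α : ℝ} (hα : -1 < α) (k : ℕ) :
    X * derivative (laguerrePolynomial α k) =
      C (k + 1 : ℝ) * laguerrePolynomial α (k + 1) -
        (C (k + α + 1) - X) * laguerrePolynomial α k := by
  have hpos (i : ℕ) : 0 < α + i + 1 := by linarith [i.cast_nonneg (α := ℝ)]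
  have hΓ (i : ℕ) : Gamma (α + i + 1) ≠ 0 := (Gamma_pos_of_pos (hpos i)).ne'
  have hΓ_succ (i : ℕ) : Gamma (α + (i + 1 : ℕ) + 1) = (α + i + 1) * Gamma (α + i + 1) := by
    rw [← Gamma_add_one (hpos i).ne']
    push_cast
    ring_nf
  ext (_ | i) <;>
    simp only [coeff_X_mul_zero, coeff_X_mul, coeff_derivative, coeff_sub, sub_mul, coeff_C_mul,
      coeff_laguerrePolynomial, add_comm _ α, hΓ_succ, Nat.factorial_succ, Nat.choose_zero_right]
  · have := hΓ 0
    push_cast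
    field_simp
    ring
  · have hchoose : ((k.choose (i + 1) : ℕ) : ℝ) * (i + 1) = k.choose i * (k - i) := by
      rcases le_or_gt i k with hi | hi
      · exact_mod_cast congrArg (Nat.cast (R := ℝ)) (Nat.choose_succ_right_eq k i)
      · simp [Nat.choose_eq_zero_of_lt hi, Nat.choose_eq_zero_of_lt (hi.trans i.lt_succ_self)]
    have := hΓ i
    have := (hpos i).ne'
    rw [Nat.choose_succ_succ]
    push_cast
    field_simp
    linear_combination (-Gamma (α + k + 1) * (-1) ^ i) * hchoose

theorem integrableOn_eval_mul_rpow_mul_exp_neg {α : ℝ} (hα : -1 < α) (p : ℝ[X]) :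
    IntegrableOn (fun x => p.eval x * x ^ α * exp (-x)) (Ioi 0) := by
  induction p using Polynomial.induction_on' with
  | add p q hp hq =>
    simp only [eval_add, add_mul]
    exact hp.add hq
  | monomial i c =>
    have hΓ := (GammaIntegral_convergent (s := i + α + 1)
      (by linarith [i.cast_nonneg (α := ℝ)])).const_mul c
    refine IntegrableOn.congr_fun hΓ (fun x (hx : 0 < x) => ?_) measurableSet_Ioi
    simp only [eval_monomial, add_sub_cancel_right, rpow_add hx, rpow_natCast]
    ring

theorem integral_eval_sq_mul_rpow_mul_exp_neg_pos {α : ℝ} (hα : -1 < α) {p : ℝ[X]} (hp : p ≠ 0) :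
    0 < ∫ x in Ioi (0 : ℝ), p.eval x ^ 2 * x ^ α * exp (-x) := by
  have hint := integrableOn_eval_mul_rpow_mul_exp_neg hα (p ^ 2)
  simp only [eval_pow] at hint
  rw [setIntegral_pos_iff_support_of_nonneg_ae _ hint]
  · have hsub : Ioi 0 \ {x | p.IsRoot x} ⊆
        (Function.support fun x => p.eval x ^ 2 * x ^ α * exp (-x)) ∩ Ioi 0 := fun x hx => by
      have hxα : x ^ α ≠ 0 := (rpow_pos_of_pos hx.1 α).ne'
      have hpx : p.eval x ≠ 0 := hx.2
      exact ⟨by simp [hxα, hpx], hx.1⟩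
    have hroots : volume {x | p.IsRoot x} = 0 := (finite_setOfPred_isRoot hp).measure_zero _
    calc (0 : ENNReal) < volume (Ioi (0 : ℝ)) := by simp only [volume_Ioi, ENNReal.zero_lt_top]
      _ = volume (Ioi 0 \ {x | p.IsRoot x}) := (measure_sdiff_null hroots).symm
      _ ≤ _ := measure_mono hsub
  · filter_upwards [ae_restrict_mem measurableSet_Ioi] with x (hx : 0 < x)
    simp only [Pi.zero_apply]
    positivity

theorem integral_laguerre_sq_pos {α : ℝ} (hα : -1 < α) (k : ℕ) :
    0 < ∫ x in Ioi (0 : ℝ), laguerre α k x ^ 2 * x ^ α * exp (-x) := by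
  simpa only [eval_laguerrePolynomial] using
    integral_eval_sq_mul_rpow_mul_exp_neg_pos hα (laguerrePolynomial_ne_zero hα k)

theorem laguerre_zero {α : ℝ} (hα : -1 < α) (x : ℝ) : laguerre α 0 x = 1 := by
  have hΓ : Gamma (α + 1) ≠ 0 := (Gamma_pos_of_pos (by linarith)).ne'
  simp [laguerre, hΓ]

theorem exists_hasDerivAt_laguerre {α : ℝ} (hα : -1 < α) (k : ℕ) (x : ℝ) :
    ∃ D, HasDerivAt (laguerre α k) D x ∧
      x * D = (k + 1) * laguerre α (k + 1) x - (k + α + 1 - x) * laguerre α k x := by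
  refine ⟨_, ((laguerrePolynomial α k).hasDerivAt x).congr_of_eventuallyEq
    (.of_forall fun t => (eval_laguerrePolynomial α k t).symm), ?_⟩
  simpa only [eval_mul, eval_sub, eval_X, eval_C, eval_laguerrePolynomial] using
    congrArg (eval x) (X_mul_derivative_laguerrePolynomial hα k)

theorem hasDerivAt_rpow_mul_laguerre_div {α : ℝ} (hα : -1 < α) (k : ℕ) (s : ℝ) {b : ℝ}
    (hb : 0 < b) :
    HasDerivAt (fun b => b ^ (-(α + 1) - k) * (laguerre α k (s / b) * exp (-(s / b))))
      (-(k + 1) * (b ^ (-(α + 1) - (k + 1 : ℕ)) *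
        (laguerre α (k + 1) (s / b) * exp (-(s / b))))) b := by
  obtain ⟨D, hL, hD⟩ := exists_hasDerivAt_laguerre hα k (s / b)
  have hdiv : HasDerivAt (fun b : ℝ => s / b) (-(s / b) / b) b :=
    ((hasDerivAt_inv hb.ne').const_mul s).congr_deriv (by field_simp)
  have hpow := hasDerivAt_rpow_const (x := b) (p := -(α + 1) - k) (Or.inl hb.ne')
  have hexp : HasDerivAt (fun b => exp (-(s / b))) _ b := hdiv.fun_neg.exp
  have hsub : (-(α + 1) - k - 1 : ℝ) = -(α + 1) - (k + 1 : ℕ) := by push_cast; ring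
  have hrpow : b ^ (-(α + 1) - k) = b * b ^ (-(α + 1) - (k + 1 : ℕ)) := by
    rw [← hsub, rpow_sub_one hb.ne']
    field_simp
  refine (hpow.mul ((hL.comp b hdiv).mul hexp)).congr_deriv ?_
  simp only [Function.comp, Pi.mul_apply, hsub, hrpow]
  field_simp at hD ⊢
  linear_combination -hD

end LaguerrePolynomial

section RadialIntegral

open MeasureTheory Module Set Real

variable {V E : Type*} [NormedAddCommGroup V] [NormedSpace ℝ V] [FiniteDimensional ℝ V]
  [MeasurableSpace V] [BorelSpace V] [Nontrivial V] (μ : Measure V) [μ.IsAddHaarMeasure]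
  [NormedAddCommGroup E] [NormedSpace ℝ E]

theorem integral_comp_norm_sq (g : ℝ → E) :
    ∫ x, g (‖x‖ ^ 2) ∂μ =
      (μ.toSphere.real univ / 2) •
        ∫ s in Ioi (0 : ℝ), s ^ ((finrank ℝ V : ℝ) / 2 - 1) • g s := by
  have hsubst : ∫ s in Ioi (0 : ℝ), s ^ ((finrank ℝ V : ℝ) / 2 - 1) • g s =
      (2 : ℝ) • ∫ r in Ioi (0 : ℝ), r ^ (finrank ℝ V - 1) • g (r ^ 2) := by
    rw [← integral_comp_rpow_Ioi_of_pos two_pos, ← integral_smul]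
    refine setIntegral_congr_fun measurableSet_Ioi fun r (hr : 0 < r) => ?_
    have hpow : r ^ ((2 : ℝ) - 1) * (r ^ 2) ^ ((finrank ℝ V : ℝ) / 2 - 1) =
        r ^ (finrank ℝ V - 1) := by
      rw [← rpow_natCast r 2, ← rpow_mul hr.le, ← rpow_add hr, ← rpow_natCast,
        Nat.cast_pred finrank_pos]
      congr 1
      push_cast
      ring
    simp only [rpow_two, smul_smul, mul_assoc, hpow]
  rw [integral_fun_norm_addHaar μ (fun r => g (r ^ 2)), hsubst, smul_smul,
    div_mul_cancel₀ _ two_ne_zero, Measure.toSphere_real_apply_univ, mul_smul,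
    Nat.cast_smul_eq_nsmul]

theorem toSphere_real_univ_pos : 0 < μ.toSphere.real univ := by
  have : NeZero μ.toSphere := ⟨μ.toSphere_ne_zero⟩
  exact measureReal_univ_pos

end RadialIntegral

section NormPowGaussian

open MeasureTheory Module Set Real

/-- The function `x ↦ ‖x‖ ^ (2j) * exp (-b ‖x‖ ^ 2)`, whose Fourier transform is a Laguerre
polynomial of degree `j` in `‖w‖ ^ 2` times a Gaussian. -/
noncomputable def normPowGaussian {V : Type*} [Norm V] (j : ℕ) (b : ℝ) (x : V) : ℝ :=
  (‖x‖ ^ 2) ^ j * exp (-(b * ‖x‖ ^ 2))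

variable {V : Type*} [NormedAddCommGroup V]

theorem normPowGaussian_nonneg (j : ℕ) (b : ℝ) (x : V) : 0 ≤ normPowGaussian j b x := by
  unfold normPowGaussian
  positivity

theorem continuous_normPowGaussian (j : ℕ) (b : ℝ) :
    Continuous (normPowGaussian j b : V → ℝ) := by
  unfold normPowGaussian
  fun_prop

theorem normPowGaussian_le_of_le (j : ℕ) {b c : ℝ} (hbc : b ≤ c) (x : V) :
    normPowGaussian j c x ≤ normPowGaussian j b x := by
  unfold normPowGaussian
  gcongr

theorem hasDerivAt_normPowGaussian (j : ℕ) (b : ℝ) (x : V) :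
    HasDerivAt (fun b => normPowGaussian j b x) (-normPowGaussian (j + 1) b x) b := by
  have hexp : HasDerivAt (fun b => exp (-(b * ‖x‖ ^ 2))) _ b :=
    (hasDerivAt_mul_const (‖x‖ ^ 2)).fun_neg.exp
  refine (hexp.const_mul ((‖x‖ ^ 2) ^ j)).congr_deriv ?_
  simp only [normPowGaussian]
  ring

theorem integrable_normPowGaussian [NormedSpace ℝ V] [FiniteDimensional ℝ V] [MeasurableSpace V]
    [BorelSpace V] (μ : Measure V) [μ.IsAddHaarMeasure] (j : ℕ) {b : ℝ} (hb : 0 < b) :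
    Integrable (normPowGaussian j b) μ := by
  nontriviality V
  refine (integrable_fun_norm_addHaar μ (f := fun r => (r ^ 2) ^ j * exp (-(b * r ^ 2)))).2 ?_
  have hint := integrableOn_rpow_mul_exp_neg_mul_sq hb (s := (finrank ℝ V - 1 + 2 * j : ℕ))
    (neg_one_lt_zero.trans_le (Nat.cast_nonneg _))
  refine hint.congr_fun (fun r _ => ?_) measurableSet_Ioi
  simp only [smul_eq_mul, rpow_natCast, neg_mul, pow_add, pow_mul, mul_assoc]

end NormPowGaussian

section Fourier

open MeasureTheory Module Set Real Filter Topology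

variable {V : Type*} [NormedAddCommGroup V] [InnerProductSpace ℝ V] [FiniteDimensional ℝ V]
  [MeasurableSpace V] [BorelSpace V]

theorem hasDerivAt_fourier_normPowGaussian (j : ℕ) (w : V) {b : ℝ} (hb : 0 < b) :
    HasDerivAt (fun b : ℝ => 𝓕 (fun x : V => (normPowGaussian j b x : ℂ)) w)
      (-𝓕 (fun x : V => (normPowGaussian (j + 1) b x : ℂ)) w) b := by
  have hnorm (x : V) (k : ℕ) (c : ℝ) :
      ‖(𝐞 (-inner ℝ x w) : Circle) • (normPowGaussian k c x : ℂ)‖ = normPowGaussian k c x := by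
    rw [Circle.norm_smul, Complex.norm_real, norm_of_nonneg (normPowGaussian_nonneg k c x)]
  have hmeas (k : ℕ) (c : ℝ) : AEStronglyMeasurable
      (fun x : V => (𝐞 (-inner ℝ x w) : Circle) • (normPowGaussian k c x : ℂ)) volume := by
    have hg := continuous_normPowGaussian (V := V) k c
    exact Continuous.aestronglyMeasurable (by fun_prop)
  simp only [Real.fourier_eq, ← integral_neg]
  refine (hasDerivAt_integral_of_dominated_loc_of_deriv_le (𝕜 := ℝ) (Ioi_mem_nhds (half_lt_self hb))
    (F' := fun c x => -((𝐞 (-inner ℝ x w) : Circle) • (normPowGaussian (j + 1) c x : ℂ)))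
    (bound := normPowGaussian (j + 1) (b / 2)) (.of_forall fun c => hmeas j c) ?_
    (hmeas (j + 1) b).neg ?_ (integrable_normPowGaussian volume (j + 1) (half_pos hb)) ?_).2
  · exact (integrable_normPowGaussian volume j hb).mono' (hmeas j b)
      (.of_forall fun x => (hnorm x j b).le)
  · refine .of_forall fun x c (hc : b / 2 < c) => ?_
    rw [norm_neg, hnorm]
    exact normPowGaussian_le_of_le _ hc.le x
  · refine .of_forall fun x c _ => ?_
    simpa using (hasDerivAt_normPowGaussian j c x).ofReal_comp.fun_const_smul (𝐞 (-inner ℝ x w))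

theorem fourier_normPowGaussian [Nontrivial V] (j : ℕ) (w : V) {b : ℝ} (hb : 0 < b) :
    𝓕 (fun x : V => (normPowGaussian j b x : ℂ)) w =
      ((π ^ ((finrank ℝ V : ℝ) / 2) * j.factorial * (b ^ (-((finrank ℝ V : ℝ) / 2) - j) *
        (laguerre ((finrank ℝ V : ℝ) / 2 - 1) j (π ^ 2 * ‖w‖ ^ 2 / b) *
          exp (-(π ^ 2 * ‖w‖ ^ 2 / b)))) : ℝ) : ℂ) := by
  have hα : -1 < (finrank ℝ V : ℝ) / 2 - 1 := by
    linarith [half_pos (Nat.cast_pos (α := ℝ).2 (finrank_pos (R := ℝ) (M := V)))]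
  induction j generalizing b with
  | zero =>
    have hgauss := fourier_gaussian_innerProductSpace (V := V) (b := b) (by simpa using hb) w
    have hconst : ((π : ℂ) / b) ^ ((finrank ℝ V : ℂ) / 2) =
        ((π ^ ((finrank ℝ V : ℝ) / 2) * b ^ (-((finrank ℝ V : ℝ) / 2)) : ℝ) : ℂ) := by
      rw [rpow_neg hb.le, ← div_eq_mul_inv, ← div_rpow pi_pos.le hb.le,
        Complex.ofReal_cpow (by positivity)]
      push_cast
      rfl
    simp only [normPowGaussian, laguerre_zero hα, ← neg_mul]
    push_cast at hgauss hconst ⊢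
    simp only [pow_zero, one_mul, hgauss, hconst]
    simp [neg_div, mul_assoc]
  | succ j ih =>
    have hderiv := ((hasDerivAt_rpow_mul_laguerre_div hα j (π ^ 2 * ‖w‖ ^ 2) hb).const_mul
      (π ^ ((finrank ℝ V : ℝ) / 2) * j.factorial)).ofReal_comp
    rw [sub_add_cancel] at hderiv
    have huniq := (hasDerivAt_fourier_normPowGaussian j w hb).unique
      (hderiv.congr_of_eventuallyEq ((eventually_gt_nhds hb).mono fun c hc => ih hc))
    rw [neg_eq_iff_eq_neg.1 huniq, Nat.factorial_succ]
    push_cast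
    ring

theorem continuous_fourier {F : V → ℂ} (hF : Integrable F) : Continuous (𝓕 F) :=
  VectorFourier.fourierIntegral_continuous continuous_fourierChar (innerSL ℝ).continuous₂ hF

theorem factorsThrough_norm_fourier {F : V → ℂ} (hF : F.FactorsThrough norm) :
    (𝓕 F).FactorsThrough norm := by
  intro v w h
  let A := (ℝ ∙ (v - w))ᗮ.reflection
  calc 𝓕 F v = 𝓕 (F ∘ A) v := by rw [(funext fun x => hF (A.norm_map x) : F ∘ A = F)]
    _ = 𝓕 F (A v) := Real.fourier_comp_linearIsometry A F v
    _ = 𝓕 F w := by rw [Submodule.reflection_sub h]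

theorem integral_fourier_mul_eq {F H : V → ℂ} (hF : Integrable F) (hH : Integrable H) :
    ∫ x, 𝓕 F x * H x = ∫ x, F x * 𝓕 H x := by
  have hflip := VectorFourier.integral_fourierIntegral_smul_eq_flip (L := innerₗ V)
    continuous_fourierChar (innerSL ℝ).continuous₂ hF hH
  rwa [flip_innerₗ] at hflip

end Fourier

section PostWidder

open MeasureTheory Module ProbabilityTheory Set Real Filter Topology

variable {E : Type*} [NormedAddCommGroup E]

theorem exists_forall_norm_sub_le_add_mul_sq {g : ℝ → E} {C : ℝ} (hC : ∀ s, ‖g s‖ ≤ C) {x : ℝ}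
    (hx : ContinuousAt g x) {ε : ℝ} (hε : 0 < ε) :
    ∃ K, ∀ s, ‖g s - g x‖ ≤ ε + K * (s - x) ^ 2 := by
  obtain ⟨δ, hδ, hnear⟩ := Metric.continuousAt_iff.1 hx ε hε
  have hC0 : 0 ≤ C := (norm_nonneg _).trans (hC x)
  refine ⟨2 * C / δ ^ 2, fun s => ?_⟩
  rcases lt_or_ge |s - x| δ with hs | hs
  · have hlt : ‖g s - g x‖ < ε := by simpa only [dist_eq_norm] using hnear hs
    exact hlt.le.trans (le_add_of_nonneg_right (by positivity))
  · have hsq : δ ^ 2 ≤ (s - x) ^ 2 := by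
      rw [← sq_abs (s - x)]
      gcongr
    calc ‖g s - g x‖ ≤ ‖g s‖ + ‖g x‖ := norm_sub_le _ _
      _ ≤ 2 * C := by linarith [hC s, hC x]
      _ = 2 * C / δ ^ 2 * δ ^ 2 := by field_simp
      _ ≤ 2 * C / δ ^ 2 * (s - x) ^ 2 := by gcongr
      _ ≤ ε + 2 * C / δ ^ 2 * (s - x) ^ 2 := le_add_of_nonneg_left hε.le

variable [NormedSpace ℝ E]

theorem tendsto_integral_of_tendsto_integral_sq_sub [CompleteSpace E] {ι : Type*} {l : Filter ι}
    {μ : ι → Measure ℝ} [∀ i, IsProbabilityMeasure (μ i)] {x : ℝ}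
    (hint : ∀ i, Integrable (fun s => (s - x) ^ 2) (μ i))
    (hvar : Tendsto (fun i => ∫ s, (s - x) ^ 2 ∂μ i) l (𝓝 0)) {g : ℝ → E}
    (hg : StronglyMeasurable g) {C : ℝ} (hC : ∀ s, ‖g s‖ ≤ C) (hx : ContinuousAt g x) :
    Tendsto (fun i => ∫ s, g s ∂μ i) l (𝓝 (g x)) := by
  refine Metric.tendsto_nhds.2 fun ε hε => ?_
  obtain ⟨K, hK⟩ := exists_forall_norm_sub_le_add_mul_sq hC hx (half_pos hε)
  have hlim : Tendsto (fun i => ε / 2 + K * ∫ s, (s - x) ^ 2 ∂μ i) l (𝓝 (ε / 2)) := by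
    simpa using (hvar.const_mul K).const_add (ε / 2)
  filter_upwards [hlim.eventually_lt_const (half_lt_self hε)] with i hi
  have hgi : Integrable g (μ i) := .of_bound hg.aestronglyMeasurable C (.of_forall hC)
  calc dist (∫ s, g s ∂μ i) (g x) = ‖∫ s, g s - g x ∂μ i‖ := by
        rw [integral_sub hgi (integrable_const _), integral_const, probReal_univ, one_smul,
          dist_eq_norm]
    _ ≤ ∫ s, ε / 2 + K * (s - x) ^ 2 ∂μ i :=
        norm_integral_le_of_norm_le ((integrable_const _).add ((hint i).const_mul K))
          (.of_forall hK)
    _ = ε / 2 + K * ∫ s, (s - x) ^ 2 ∂μ i := by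
        rw [integral_add (integrable_const _) ((hint i).const_mul K), integral_const,
          probReal_univ, one_smul, integral_const_mul]
    _ < ε := hi

theorem integral_gammaMeasure {a r : ℝ} (ha : 0 < a) (hr : 0 < r) (g : ℝ → E) :
    ∫ s, g s ∂gammaMeasure a r =
      (r ^ a / Gamma a) • ∫ s in Ioi (0 : ℝ), (s ^ (a - 1) * exp (-(r * s))) • g s := by
  rw [gammaMeasure, integral_withDensity_eq_integral_toReal_smul (f := gammaPDF a r)
    (measurable_gammaPDFReal a r).ennreal_ofReal (.of_forall fun _ => ENNReal.ofReal_lt_top),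
    ← integral_Ici_eq_integral_Ioi, ← integral_smul, ← integral_indicator measurableSet_Ici]
  congr 1 with s
  rw [gammaPDF, ENNReal.toReal_ofReal (gammaPDFReal_nonneg ha hr s)]
  simp only [gammaPDFReal, indicator_apply, mem_Ici, ite_smul, zero_smul, smul_smul, mul_assoc]

theorem integral_pow_gammaMeasure {a r : ℝ} (ha : 0 < a) (hr : 0 < r) (k : ℕ) :
    ∫ s, s ^ k ∂gammaMeasure a r = Gamma (a + k) / (Gamma a * r ^ k) := by
  have hak : 0 < a + k := by positivity
  have hcongr : ∫ s in Ioi (0 : ℝ), (s ^ (a - 1) * exp (-(r * s))) • s ^ k =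
      ∫ s in Ioi (0 : ℝ), s ^ (a + k - 1) * exp (-(r * s)) := by
    refine setIntegral_congr_fun measurableSet_Ioi fun s (hs : 0 < s) => ?_
    simp only [smul_eq_mul, add_sub_right_comm, rpow_add_natCast hs.ne']
    ring
  rw [integral_gammaMeasure ha hr, hcongr, integral_rpow_mul_exp_neg_mul_Ioi hak hr, one_div,
    inv_rpow hr.le, rpow_add_natCast hr.ne', smul_eq_mul]
  have := (rpow_pos_of_pos hr a).ne'
  field_simp

theorem memLp_id_gammaMeasure {a r : ℝ} (ha : 0 < a) (hr : 0 < r) :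
    MemLp id 2 (gammaMeasure a r) := by
  refine (memLp_two_iff_integrable_sq aestronglyMeasurable_id).2 (.of_integral_ne_zero ?_)
  have := Gamma_pos_of_pos ha
  have : 0 < Gamma (a + (2 : ℕ)) := Gamma_pos_of_pos (by positivity)
  simp only [id, integral_pow_gammaMeasure ha hr]
  positivity

theorem integral_id_gammaMeasure {a r : ℝ} (ha : 0 < a) (hr : 0 < r) :
    ∫ s, id s ∂gammaMeasure a r = a / r := by
  have hΓ := (Gamma_pos_of_pos ha).ne'
  have hmoment := integral_pow_gammaMeasure ha hr 1
  simp only [pow_one, Nat.cast_one, Gamma_add_one ha.ne'] at hmoment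
  simp only [id, hmoment]
  field_simp

theorem variance_id_gammaMeasure {a r : ℝ} (ha : 0 < a) (hr : 0 < r) :
    variance id (gammaMeasure a r) = a / r ^ 2 := by
  have := isProbabilityMeasure_gammaMeasure ha hr
  have hΓ := (Gamma_pos_of_pos ha).ne'
  have hΓ2 : Gamma (a + (2 : ℕ)) = (a + 1) * (a * Gamma a) := by
    rw [← Gamma_add_one ha.ne', ← Gamma_add_one (by positivity)]
    push_cast
    ring_nf
  rw [variance_eq_sub (memLp_id_gammaMeasure ha hr), integral_id_gammaMeasure ha hr]
  simp only [Pi.pow_apply, id, integral_pow_gammaMeasure ha hr, hΓ2]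
  field_simp
  ring

theorem tendsto_integral_gammaMeasure [CompleteSpace E] {g : ℝ → E} (hg : StronglyMeasurable g)
    {C : ℝ} (hC : ∀ s, ‖g s‖ ≤ C) {x : ℝ} (hx : 0 < x) (hgx : ContinuousAt g x) {β : ℝ}
    (hβ : 0 < β) :
    Tendsto (fun j : ℕ => ∫ s, g s ∂gammaMeasure (β + j) ((β + j) / x)) atTop (𝓝 (g x)) := by
  have ha (j : ℕ) : 0 < β + j := by positivity
  have hr (j : ℕ) : 0 < (β + j) / x := div_pos (ha j) hx
  have (j : ℕ) := isProbabilityMeasure_gammaMeasure (ha j) (hr j)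
  refine tendsto_integral_of_tendsto_integral_sq_sub
    (fun j => ((memLp_id_gammaMeasure (ha j) (hr j)).sub (memLp_const x)).integrable_sq)
    ?_ hg hC hgx
  have hvar (j : ℕ) :
      ∫ s, (s - x) ^ 2 ∂gammaMeasure (β + j) ((β + j) / x) = x ^ 2 / (β + j) := by
    have hvariance := variance_id_gammaMeasure (ha j) (hr j)
    rw [variance_eq_integral measurable_id.aemeasurable, integral_id_gammaMeasure (ha j) (hr j),
      div_div_cancel₀ (ha j).ne'] at hvariance
    have := (ha j).ne'
    exact hvariance.trans (by field_simp)
  simp only [hvar]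
  exact tendsto_const_nhds.div_atTop (tendsto_atTop_add_const_left _ _ tendsto_natCast_atTop_atTop)

open scoped ComplexOrder in
theorem nonneg_of_forall_integral_rpow_mul_exp_nonneg {g : ℝ → ℂ} (hg : StronglyMeasurable g)
    {C : ℝ} (hC : ∀ s, ‖g s‖ ≤ C) {β : ℝ} (hβ : 0 < β)
    (hnonneg : ∀ b > 0, ∀ j : ℕ,
      0 ≤ ∫ s in Ioi (0 : ℝ), (s ^ (β + j - 1) * exp (-(b * s))) • g s)
    {x : ℝ} (hx : 0 < x) (hgx : ContinuousAt g x) : 0 ≤ g x := by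
  refine ge_of_tendsto (tendsto_integral_gammaMeasure hg hC hx hgx hβ) (.of_forall fun j => ?_)
  have ha : 0 < β + j := by positivity
  have hr : 0 < (β + j) / x := div_pos ha hx
  have := Gamma_pos_of_pos ha
  rw [integral_gammaMeasure ha hr]
  exact smul_nonneg (by positivity) (hnonneg _ hr j)

open scoped ComplexOrder in
theorem nonneg_of_forall_integral_mul_normPowGaussian_nonneg {V : Type*} [NormedAddCommGroup V]
    [NormedSpace ℝ V] [FiniteDimensional ℝ V] [MeasurableSpace V] [BorelSpace V] [Nontrivial V]
    (μ : Measure V) [μ.IsAddHaarMeasure] {G : V → ℂ} (hG : Continuous G)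
    (hrad : G.FactorsThrough norm) {C : ℝ} (hC : ∀ w, ‖G w‖ ≤ C)
    (hnonneg : ∀ b > 0, ∀ j, 0 ≤ ∫ w, G w * normPowGaussian j b w ∂μ) (w : V) : 0 ≤ G w := by
  obtain ⟨e, he⟩ := exists_norm_eq V zero_le_one
  let g : ℝ → ℂ := fun s => G (√s • e)
  have hg : Continuous g := by fun_prop
  have hgG (x : V) : g (‖x‖ ^ 2) = G x := hrad <| by
    rw [sqrt_sq (norm_nonneg x), norm_smul, he, mul_one, norm_norm]
  have hd : 0 < (finrank ℝ V : ℝ) / 2 := half_pos (Nat.cast_pos.2 finrank_pos)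
  have hmoment (b : ℝ) (hb : b > 0) (j : ℕ) : 0 ≤ ∫ s in Ioi (0 : ℝ),
      (s ^ ((finrank ℝ V : ℝ) / 2 + j - 1) * exp (-(b * s))) • g s := by
    refine nonneg_of_smul_nonneg_of_pos_left ?_ (half_pos (toSphere_real_univ_pos μ))
    calc 0 ≤ ∫ w, G w * normPowGaussian j b w ∂μ := hnonneg b hb j
      _ = (μ.toSphere.real univ / 2) • ∫ s in Ioi (0 : ℝ),
          s ^ ((finrank ℝ V : ℝ) / 2 - 1) • (s ^ j * exp (-(b * s))) • g s := by
        rw [← integral_comp_norm_sq μ]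
        simp only [hgG, normPowGaussian, Complex.real_smul, mul_comm]
      _ = _ := by
        congr 1
        refine setIntegral_congr_fun measurableSet_Ioi fun s (hs : 0 < s) => ?_
        simp only [smul_smul, ← mul_assoc, ← rpow_natCast s j, ← rpow_add hs, sub_add_eq_add_sub]
  have hpos : Ioi 0 ⊆ {s | 0 ≤ g s} := fun s hs =>
    nonneg_of_forall_integral_rpow_mul_exp_nonneg hg.stronglyMeasurable (fun s => hC _) hd hmoment
      hs hg.continuousAt
  have hclosed : IsClosed {s | 0 ≤ g s} := isClosed_le continuous_const hg
  rw [← hclosed.closure_subset_iff, closure_Ioi] at hpos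
  exact hgG w ▸ hpos (sq_nonneg ‖w‖)

end PostWidder

section LaguerreCoeff

open MeasureTheory Module Set Real
open scoped ComplexOrder

variable (V : Type*) [NormedAddCommGroup V] [InnerProductSpace ℝ V] [FiniteDimensional ℝ V]
  [MeasurableSpace V] [BorelSpace V] [Nontrivial V]

theorem integral_comp_div_mul_laguerre (f : ℝ≥0 → ℝ) {y : ℝ≥0} (hy : 0 < y) (j : ℕ) :
    (volume : Measure V).toSphere.real univ / 2 *
      ∫ x in Ioi (0 : ℝ), f (x.toNNReal / y) * laguerre ((finrank ℝ V : ℝ) / 2 - 1) j x *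
        x ^ ((finrank ℝ V : ℝ) / 2 - 1) * exp (-x) =
    (y : ℝ) ^ ((finrank ℝ V : ℝ) / 2) * ∫ x : V, f (‖x‖₊ ^ 2) *
      (laguerre ((finrank ℝ V : ℝ) / 2 - 1) j (y * ‖x‖ ^ 2) * exp (-(y * ‖x‖ ^ 2))) := by
  have hy' : (0 : ℝ) < y := hy
  have hpolar := integral_comp_norm_sq (volume : Measure V) fun s =>
    f s.toNNReal * (laguerre ((finrank ℝ V : ℝ) / 2 - 1) j (y * s) * exp (-(y * s)))
  have hnorm (x : V) : (‖x‖ ^ 2).toNNReal = ‖x‖₊ ^ 2 := by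
    rw [toNNReal_pow (norm_nonneg x), norm_toNNReal]
  simp only [hnorm, smul_eq_mul] at hpolar
  rw [hpolar, mul_left_comm]
  congr 1
  rw [← mul_zero (y : ℝ), ← integral_comp_mul_left_Ioi' _ _ hy', ← integral_smul,
    ← integral_const_mul, mul_zero]
  refine setIntegral_congr_fun measurableSet_Ioi fun s (hs : 0 < s) => ?_
  have hdiv : (y * s : ℝ).toNNReal / y = s.toNNReal := by
    rw [toNNReal_mul hy'.le, toNNReal_coe, mul_div_cancel_left₀ _ hy.ne']
  have hpow : (y : ℝ) ^ ((finrank ℝ V : ℝ) / 2) = y * (y : ℝ) ^ ((finrank ℝ V : ℝ) / 2 - 1) := by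
    rw [rpow_sub_one hy'.ne', mul_div_cancel₀ _ hy'.ne']
  simp only [hdiv, mul_rpow hy'.le hs.le, hpow, smul_eq_mul]
  ring

variable {V}

theorem integral_fourier_mul_normPowGaussian {F : V → ℝ} (hF : Integrable F) {y : ℝ} (hy : 0 < y)
    (j : ℕ) :
    ∫ w, 𝓕 (fun x => (F x : ℂ)) w * normPowGaussian j (π ^ 2 / y) w =
      ((π ^ ((finrank ℝ V : ℝ) / 2) * j.factorial *
        (π ^ 2 / y) ^ (-((finrank ℝ V : ℝ) / 2) - j) * ∫ x, F x *
          (laguerre ((finrank ℝ V : ℝ) / 2 - 1) j (y * ‖x‖ ^ 2) * exp (-(y * ‖x‖ ^ 2))) : ℝ) :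
        ℂ) := by
  have hb : 0 < π ^ 2 / y := by positivity
  have hdiv (x : V) : π ^ 2 * ‖x‖ ^ 2 / (π ^ 2 / y) = y * ‖x‖ ^ 2 := by field_simp
  have hflip := integral_fourier_mul_eq (F := fun x => (F x : ℂ))
    (H := fun x => (normPowGaussian j (π ^ 2 / y) x : ℂ)) hF.ofReal
    (integrable_normPowGaussian volume j hb).ofReal
  rw [hflip, ← integral_const_mul, ← integral_complex_ofReal]
  congr 1 with x
  rw [fourier_normPowGaussian j x hb, hdiv]
  push_cast
  ring

theorem laguerreCoeff_nonneg_iff (f : ℝ≥0 → ℝ) (hF : Integrable fun x : V => f (‖x‖₊ ^ 2))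
    {y : ℝ≥0} (hy : 0 < y) (j : ℕ) :
    0 ≤ laguerreCoeff ((finrank ℝ V : ℝ) / 2 - 1) (fun x => f (x / y)) j ↔
      0 ≤ ∫ w : V, 𝓕 (fun x : V => (f (‖x‖₊ ^ 2) : ℂ)) w * normPowGaussian j (π ^ 2 / y) w := by
  have hα : -1 < (finrank ℝ V : ℝ) / 2 - 1 := by
    linarith [half_pos (Nat.cast_pos (α := ℝ).2 (finrank_pos (R := ℝ) (M := V)))]
  have hy' : (0 : ℝ) < y := hy
  have hS := half_pos (toSphere_real_univ_pos (volume : Measure V))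
  rw [laguerreCoeff, le_div_iff₀ (integral_laguerre_sq_pos hα j), zero_mul,
    ← mul_nonneg_iff_of_pos_left hS, integral_comp_div_mul_laguerre V f hy,
    integral_fourier_mul_normPowGaussian hF hy', Complex.zero_le_real,
    mul_nonneg_iff_of_pos_left (by positivity), mul_nonneg_iff_of_pos_left (by positivity)]

theorem forall_laguerreCoeff_nonneg_iff (f : ℝ≥0 → ℝ)
    (hF : Integrable fun x : V => f (‖x‖₊ ^ 2)) :
    (∀ y : ℝ≥0, 0 < y → ∀ j,
      0 ≤ laguerreCoeff ((finrank ℝ V : ℝ) / 2 - 1) (fun x => f (x / y)) j) ↔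
    ∀ w : V, 0 ≤ 𝓕 (fun x : V => (f (‖x‖₊ ^ 2) : ℂ)) w := by
  constructor
  · intro hcoeff
    have hrad : (fun x : V => (f (‖x‖₊ ^ 2) : ℂ)).FactorsThrough norm := fun x z h => by
      simp only [show ‖x‖₊ = ‖z‖₊ from NNReal.eq h]
    refine nonneg_of_forall_integral_mul_normPowGaussian_nonneg volume
      (continuous_fourier hF.ofReal) (factorsThrough_norm_fourier hrad)
      (VectorFourier.norm_fourierIntegral_le_integral_norm _ _ _ _) fun b hb j => ?_
    have hy : 0 < π ^ 2 / b := by positivity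
    have hmoment := (laguerreCoeff_nonneg_iff f hF (toNNReal_pos.2 hy) j).1
      (hcoeff _ (toNNReal_pos.2 hy) j)
    rwa [coe_toNNReal _ hy.le, div_div_cancel₀ (by positivity)] at hmoment
  · intro hpos y hy j
    refine (laguerreCoeff_nonneg_iff f hF hy j).2 (integral_nonneg fun w => ?_)
    exact mul_nonneg (hpos w) (Complex.zero_le_real.2 (normPowGaussian_nonneg _ _ _))

end LaguerreCoeff

section Distribution

open MeasureTheory Filter Topology Convolution
open scoped ComplexOrder ContDiff

section Nonneg

variable {V : Type*} [NormedAddCommGroup V] [InnerProductSpace ℝ V] [FiniteDimensional ℝ V]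
  [MeasurableSpace V] [BorelSpace V]

theorem nonneg_of_forall_schwartz_integral_nonneg {G : V → ℂ} (hG : Continuous G)
    (hnonneg : ∀ φ : 𝓢(V, ℂ), HasCompactSupport φ → (∀ x, 0 ≤ φ x) → 0 ≤ ∫ x, φ x * G x) (w : V) :
    0 ≤ G w := by
  let bump (k : ℕ) : ContDiffBump (0 : V) :=
    ⟨1 / (k + 1), 2 * (1 / (k + 1)), by positivity, lt_two_mul_self (by positivity)⟩
  have hbump : Tendsto (fun k => (bump k).rOut) atTop (𝓝 0) := by
    simpa only [mul_zero] using (tendsto_one_div_add_atTop_nhds_zero_nat (𝕜 := ℝ)).const_mul 2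
  have happrox (x : V) : Tendsto (fun k => ∫ z, ((bump k).normed volume (x - z) : ℂ) * G z) atTop
      (𝓝 (G x)) := by
    simpa only [convolution_lsmul_swap, Complex.real_smul] using
      ContDiffBump.convolution_tendsto_right_of_continuous (μ := volume) hbump hG x
  refine ge_of_tendsto (happrox w) (.of_forall fun k => ?_)
  have hsupp : HasCompactSupport fun x => ((bump k).normed volume (w - x) : ℂ) :=
    ((bump k).hasCompactSupport_normed.comp_homeomorph (.subLeft w)).comp_left Complex.ofReal_zero
  have hsmooth : ContDiff ℝ ∞ fun x => ((bump k).normed volume (w - x) : ℂ) :=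
    Complex.ofRealCLM.contDiff.comp ((bump k).contDiff_normed.comp (contDiff_const.sub contDiff_id))
  exact hnonneg (hsupp.toSchwartzMap hsmooth) hsupp fun x =>
    Complex.zero_le_real.2 ((bump k).nonneg_normed _)

theorem integrable_schwartz_mul (φ : 𝓢(V, ℂ)) {F : V → ℂ} (hF : Integrable F) :
    Integrable fun x => φ x * F x :=
  hF.bdd_mul φ.continuous.aestronglyMeasurable (.of_forall (φ.norm_le_seminorm ℝ))

end Nonneg

variable {n : ℕ} {F : EuclideanSpace ℝ (Fin n) → ℝ}

theorem exists_isGivenBy (hF : Integrable F) : ∃ S, IsGivenBy S F := by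
  have hmem : MemLp (fun x => (F x : ℂ)) 1 volume := memLp_one_iff_integrable.2 hF.ofReal
  refine ⟨Lp.toTemperedDistribution (hmem.toLp _), fun φ =>
    ⟨integrable_schwartz_mul φ hF.ofReal, ?_⟩⟩
  rw [Lp.toTemperedDistribution_apply]
  refine integral_congr_ae ?_
  filter_upwards [hmem.coeFn_toLp] with x hx
  rw [hx, smul_eq_mul]

theorem fourier_apply_of_isGivenBy (hF : Integrable F)
    {S : 𝓢'(EuclideanSpace ℝ (Fin n), ℂ)} (hS : IsGivenBy S F)
    (φ : 𝓢(EuclideanSpace ℝ (Fin n), ℂ)) :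
    𝓕 S φ = ∫ x, φ x * 𝓕 (fun x => (F x : ℂ)) x := by
  rw [TemperedDistribution.fourier_apply, (hS (𝓕 φ)).2, SchwartzMap.fourier_coe]
  exact integral_fourier_mul_eq φ.integrable hF.ofReal

theorem isFourierTransformOfNonneg_iff (hF : Integrable F) :
    IsFourierTransformOfNonneg F ↔ ∀ w, 0 ≤ 𝓕 (fun x => (F x : ℂ)) w := by
  constructor
  · rintro ⟨T, hT, hTF⟩
    refine nonneg_of_forall_schwartz_integral_nonneg (continuous_fourier hF.ofReal)
      fun φ hφ_supp hφ_nonneg => ?_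
    have hTφ := fourier_apply_of_isGivenBy hF hTF φ
    rw [FourierTransform.fourier_fourierInv_eq] at hTφ
    exact hTφ ▸ hT φ hφ_supp hφ_nonneg
  · intro hpos
    obtain ⟨S, hS⟩ := exists_isGivenBy hF
    refine ⟨𝓕 S, fun φ _ hφ_nonneg => ?_, ?_⟩
    · rw [fourier_apply_of_isGivenBy hF hS]
      exact integral_nonneg fun x => mul_nonneg (hφ_nonneg x) (hpos x)
    · rwa [FourierTransform.fourierInv_fourier_eq]

end Distribution

section Decay

open MeasureTheory Module Topology

section NormSq

variable (V : Type*) [NormedAddCommGroup V] [InnerProductSpace ℝ V] [Nontrivial V]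

theorem isQuotientMap_nnnorm_sq : IsQuotientMap fun x : V => ‖x‖₊ ^ 2 := by
  obtain ⟨e, he⟩ := exists_norm_eq V zero_le_one
  refine .of_inverse (f := fun t => (NNReal.sqrt t : ℝ) • e) (by fun_prop) (by fun_prop) fun t => ?_
  rw [nnnorm_smul, show ‖e‖₊ = 1 from NNReal.eq he, mul_one, NNReal.nnnorm_eq, NNReal.sq_sqrt]

theorem exists_decay_iff_comp_nnnorm_sq {r : ℝ} (hr : 0 ≤ r) (f : ℝ≥0 → ℝ) :
    (∃ ε > (0 : ℝ), ∃ C > (0 : ℝ), ∀ t : ℝ≥0, |f t| ≤ C * (1 + (t : ℝ)) ^ (-(r / 2) - ε)) ↔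
      ∃ C > (0 : ℝ), ∃ ε > (0 : ℝ), ∀ x : V, |f (‖x‖₊ ^ 2)| ≤ C * (1 + ‖x‖) ^ (-r - ε) := by
  simp only [(isQuotientMap_nnnorm_sq V).surjective.forall, NNReal.coe_pow, coe_nnnorm]
  constructor
  · rintro ⟨ε, hε, C, hC, h⟩
    refine ⟨C * 2 ^ ((r + 2 * ε) / 2), by positivity, 2 * ε, by positivity, fun x => ?_⟩
    calc |f (‖x‖₊ ^ 2)| ≤ C * (1 + ‖x‖ ^ 2) ^ (-(r + 2 * ε) / 2) := by convert h x using 3; ring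
      _ ≤ C * (2 ^ ((r + 2 * ε) / 2) * (1 + ‖x‖) ^ (-(r + 2 * ε))) := by
        gcongr
        exact rpow_neg_one_add_norm_sq_le x (by positivity)
      _ = C * 2 ^ ((r + 2 * ε) / 2) * (1 + ‖x‖) ^ (-r - 2 * ε) := by rw [neg_add', mul_assoc]
  · rintro ⟨C, hC, ε, hε, h⟩
    refine ⟨ε / 2, by positivity, C, hC, fun x => (h x).trans ?_⟩
    calc C * (1 + ‖x‖) ^ (-r - ε) ≤ C * √(1 + ‖x‖ ^ 2) ^ (-r - ε) := by
          gcongr ?_ * ?_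
          exact Real.rpow_le_rpow_of_nonpos (by positivity) (sqrt_one_add_norm_sq_le x)
            (by linarith)
      _ = C * (1 + ‖x‖ ^ 2) ^ (-(r / 2) - ε / 2) := by
        rw [Real.sqrt_eq_rpow, ← Real.rpow_mul (by positivity)]
        ring_nf

end NormSq

theorem integrable_of_decay {V : Type*} [NormedAddCommGroup V] [InnerProductSpace ℝ V]
    [FiniteDimensional ℝ V] [MeasurableSpace V] [BorelSpace V] {F : V → ℝ} (hF : Continuous F)
    (hdecay : ∃ C > (0 : ℝ), ∃ ε > (0 : ℝ), ∀ x,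
      |F x| ≤ C * (1 + ‖x‖) ^ (-(finrank ℝ V : ℝ) - ε)) :
    Integrable F := by
  obtain ⟨C, -, ε, hε, h⟩ := hdecay
  refine ((integrable_one_add_norm (r := finrank ℝ V + ε) (by simpa using hε)).const_mul C).mono'
    hF.aestronglyMeasurable (.of_forall fun x => ?_)
  rw [neg_add']
  exact h x

theorem isSILP_iff {α : ℝ} {f : ℝ≥0 → ℝ} :
    IsSILP α f ↔ Continuous f ∧
      (∃ ε > (0 : ℝ), ∃ C > (0 : ℝ), ∀ t : ℝ≥0, |f t| ≤ C * (1 + (t : ℝ)) ^ (-(α + 1) - ε)) ∧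
      ∀ y : ℝ≥0, 0 < y → ∀ j, 0 ≤ laguerreCoeff α (fun x => f (x / y)) j := by
  rw [neg_add']
  exact ⟨fun h => ⟨h.continuous, h.decay, h.coeff_nonneg⟩, fun ⟨hf, hd, hc⟩ => ⟨hf, hd, hc⟩⟩

end Decay

theorem corollary2p10_general (n : ℕ) (hn : 0 < n) (f : ℝ≥0 → ℝ) :
    IsSILP ((n : ℝ) / 2 - 1) f ↔
      Continuous (fun x : EuclideanSpace ℝ (Fin n) => f (‖x‖₊ ^ 2)) ∧
      (∃ C > (0 : ℝ), ∃ ε > (0 : ℝ), ∀ x : EuclideanSpace ℝ (Fin n),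
        |f (‖x‖₊ ^ 2)| ≤ C * (1 + ‖x‖) ^ (-(n : ℝ) - ε)) ∧
      IsFourierTransformOfNonneg (fun x : EuclideanSpace ℝ (Fin n) => f (‖x‖₊ ^ 2)) := by
  have : Nonempty (Fin n) := ⟨⟨0, hn⟩⟩
  have hdim : Module.finrank ℝ (EuclideanSpace ℝ (Fin n)) = n := finrank_euclideanSpace_fin
  rw [isSILP_iff, sub_add_cancel,
    (isQuotientMap_nnnorm_sq (EuclideanSpace ℝ (Fin n))).continuous_iff,
    exists_decay_iff_comp_nnnorm_sq (EuclideanSpace ℝ (Fin n)) n.cast_nonneg]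
  refine and_congr_right fun hcont => and_congr_right fun hdecay => ?_
  have hF : MeasureTheory.Integrable fun x : EuclideanSpace ℝ (Fin n) => f (‖x‖₊ ^ 2) :=
    integrable_of_decay hcont (hdim.symm ▸ hdecay)
  rw [isFourierTransformOfNonneg_iff hF, ← forall_laguerreCoeff_nonneg_iff f hF, hdim]

theorem corollary2p10 (n : ℕ) (hn : 1 < n) (f : ℝ≥0 → ℝ) :
    IsSILP ((n : ℝ) / 2 - 1) f ↔
      Continuous (fun x : EuclideanSpace ℝ (Fin n) => f (‖x‖₊ ^ 2)) ∧
      (∃ C > (0 : ℝ), ∃ ε > (0 : ℝ), ∀ x : EuclideanSpace ℝ (Fin n),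
        |f (‖x‖₊ ^ 2)| ≤ C * (1 + ‖x‖) ^ (-(n : ℝ) - ε)) ∧
      IsFourierTransformOfNonneg (fun x : EuclideanSpace ℝ (Fin n) => f (‖x‖₊ ^ 2)) :=
  corollary2p10_general n (by omega) f
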